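/- Let $\mathcal H$ be a complex Hilbert space, $L(\mathcal H)$ the bounded linear operators on $\mathcal H$, ordered by $X\le Y$ iff $Y-X$ is positive semidefinite (Loewner order), and $\mathcal Q=\{Q\in L(\mathcal H): Q^2=Q\}$. Write $R(T)$ and $N(T)$ for the range and nullspace of $T$. Suprema and infima of sets of operators are taken with respect to the Loewner order; an iterated extremum exists if all the inner extrema exist and the outer extremum of them exists. Let $B\in L(\mathcal H)$ be selfadjoint and $\mathcal S\subseteq\mathcal H$ a closed subspace, and write $$B=\begin{bmatrix} a & b\\ b^* & c\end{bmatrix}$$ with respect to $\mathcal H=\mathcal S\oplus\mathcal S^\perp$. $B$ is called $\mathcal S$-weakly complementable if $R(b)\subseteq R(|a|^{1/2})$, where $|a|=(a^*a)^{1/2}$. In this case let $f$ be the reduced solution of $b=|a|^{1/2}x$, i.e. the unique bounded $f:\mathcal S^\perp\to\mathcal S$ with $b=|a|^{1/2}f$, $N(f)=N(b)$ and $R(f)\subseteq\overline{R(|a|^{1/2})}$, let $a=u|a|$ be the polar decomposition of $a$ ($u$ the partial isometry with $N(u)=N(a)$), and define the Schur complement $$B_{/\mathcal S}=\begin{bmatrix}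 0&0\\0& c-f^*uf\end{bmatrix}.$$ Suppose that $\mathcal S=\mathcal S_+\oplus\mathcal S_-$ is any orthogonal decomposition into closed subspaces such that $\langle Bs,t\rangle=0$ for all $s\in\mathcal S_+$, $t\in\mathcal S_-$, $\langle Bs,s\rangle\ge 0$ for all $s\in\mathcal S_+$, and $\langle Bt,t\rangle\le 0$ for all $t\in\mathcal S_-$. Then $B$ is $\mathcal S$-weakly complementable if and only if both $$\sup_{Q_-\in\mathcal Q,\ N(Q_-)=\mathcal S_-}\Big(\inf_{Q_+\in\mathcal Q,\ N(Q_+)=\mathcal S_+} Q_-^*Q_+^*BQ_+Q_-\Big)$$ and $$\inf_{Q_+\in\mathcal Q,\ N(Q_+)=\mathcal S_+}\Big(\sup_{Q_-\in\mathcal Q,\ N(Q_-)=\mathcal S_-} Q_+^*Q_-^*BQ_-Q_+\Big)$$ exist. In this case both are equal to $B_{/\mathcal S}$. -/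

import Mathlib

open scoped InnerProductSpace
open ContinuousLinearMap

namespace SchurMinMax

noncomputable section

section Factorization

variable {E F G : Type*}
  [NormedAddCommGroup E] [InnerProductSpace ℂ E] [CompleteSpace E]
  [NormedAddCommGroup F] [InnerProductSpace ℂ F] [CompleteSpace F]
  [NormedAddCommGroup G] [InnerProductSpace ℂ G] [CompleteSpace G]

/-- `D` is the reduced solution of the operator equation `Z = Y X`: it solves the equation,
`N(D) = N(Z)`, and `R(D)` is contained in the closure of `R(Y*)`. -/
structure IsReducedSolution (Y : F →L[ℂ] E) (Z : G →L[ℂ] E) (D : G →L[ℂ] F) : Prop where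
  eq : Z = Y ∘L D
  ker_eq : D.ker = Z.ker
  range_le : D.range ≤ (adjoint Y).range.topologicalClosure

/-- `|T|^{1/2}`, where `|T| = (T* T)^{1/2}`. -/
def sqrtAbs (T : E →L[ℂ] E) : E →L[ℂ] E := CFC.sqrt (CFC.abs T)

/-- `U` is the partial isometry in the polar decomposition `T = U |T|`, normalized by
`N(U) = N(T)`. -/
structure IsPolarFactor (T U : E →L[ℂ] E) : Prop where
  eq : T = U ∘L CFC.abs T
  isometric : ∀ x ∈ U.kerᗮ, ‖U x‖ = ‖x‖
  ker_eq : U.ker = T.ker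

theorem closure_range_adjoint (Y : F →L[ℂ] E) :
    (adjoint Y).range.topologicalClosure = Y.kerᗮ := by
  rw [← Submodule.orthogonal_orthogonal_eq_closure]
  congr 1
  rw [orthogonal_range, adjoint_adjoint]

/-- Douglas' lemma: existence and uniqueness of the reduced solution. -/
theorem existsUnique_isReducedSolution (Y : F →L[ℂ] E) (Z : G →L[ℂ] E)
    (h : Z.range ≤ Y.range) : ∃! D : G →L[ℂ] F, IsReducedSolution Y Z D := by
  have hc : IsClosed (Y.ker : Set F) := Y.isClosed_ker
  have : CompleteSpace Y.ker := hc.completeSpace_coe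
  have key : ∀ v w : F, v ∈ Y.kerᗮ → w ∈ Y.kerᗮ → Y v = Y w → v = w := by
    intro v w hv hw e
    have h1 : v - w ∈ Y.ker := by simp [e]
    have h2 : v - w ∈ Y.kerᗮ := Submodule.sub_mem _ hv hw
    have := Submodule.inner_right_of_mem_orthogonal h1 h2
    exact sub_eq_zero.1 (inner_self_eq_zero.1 this)
  have hex : ∀ x : G, ∃ v : F, v ∈ Y.kerᗮ ∧ Y v = Z x := by
    intro x
    obtain ⟨w, hw⟩ := h ⟨x, rfl⟩
    refine ⟨w - Y.ker.starProjection w, Submodule.sub_starProjection_mem_orthogonal w, ?_⟩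
    have : Y (Y.ker.starProjection w) = 0 :=
      Submodule.starProjection_apply_mem Y.ker w
    rw [map_sub, this, sub_zero]
    exact hw
  choose d hd hYd using hex
  let g : G →ₗ[ℂ] F :=
    { toFun := d
      map_add' := fun x y => key _ _ (hd _) (Submodule.add_mem _ (hd x) (hd y))
        (by simp [hYd])
      map_smul' := fun c x => key _ _ (hd _) (Submodule.smul_mem _ c (hd x))
        (by simp [hYd]) }
  have hg : IsClosed (g.graph : Set (G × F)) := by
    have : (g.graph : Set (G × F)) = {p | p.2 ∈ Y.kerᗮ} ∩ {p | Y p.2 = Z p.1} := by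
      ext p
      constructor
      · intro hp
        have hp' : p.2 = d p.1 := hp
        exact ⟨by simpa [hp'] using hd p.1, by simpa [hp'] using hYd p.1⟩
      · rintro ⟨h1, h2⟩
        exact key _ _ h1 (hd p.1) (h2.trans (hYd p.1).symm)
    rw [this]
    exact ((Submodule.isClosed_orthogonal _).preimage continuous_snd).inter
      (isClosed_eq (by fun_prop) (by fun_prop))
  refine ⟨ContinuousLinearMap.ofIsClosedGraph hg, ⟨?_, ?_, ?_⟩, ?_⟩
  · ext x
    exact (hYd x).symm
  · ext x
    change d x = 0 ↔ Z x = 0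
    constructor
    · intro hx
      rw [← hYd x, hx, map_zero]
    · intro hx
      exact key _ _ (hd x) (Submodule.zero_mem _) (by rw [hYd, hx, map_zero])
  · rw [closure_range_adjoint]
    rintro _ ⟨x, rfl⟩
    exact hd x
  · intro D hD
    ext x
    have h1 : D x ∈ Y.kerᗮ := by
      rw [← closure_range_adjoint]
      exact hD.range_le ⟨x, rfl⟩
    refine key _ _ h1 (hd x) ?_
    exact (congrArg (fun A : G →L[ℂ] E => A x) hD.eq).symm.trans (hYd x).symm

theorem norm_abs_apply (T : E →L[ℂ] E) (x : E) : ‖CFC.abs T x‖ = ‖T x‖ := by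
  have hs : adjoint (CFC.abs T) = CFC.abs T := (CFC.abs_nonneg T).isSelfAdjoint
  have h1 : (adjoint (CFC.abs T)) (CFC.abs T x) = (adjoint T) (T x) := by
    rw [hs]
    exact congrArg (fun A : E →L[ℂ] E => A x) (CFC.abs_mul_abs T)
  have h2 : ‖CFC.abs T x‖ ^ 2 = ‖T x‖ ^ 2 := by
    rw [apply_norm_sq_eq_inner_adjoint_left, apply_norm_sq_eq_inner_adjoint_left]
    change RCLike.re ⟪(adjoint (CFC.abs T)) (CFC.abs T x), x⟫_ℂ =
      RCLike.re ⟪(adjoint T) (T x), x⟫_ℂ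
    rw [h1]
  exact (sq_eq_sq₀ (norm_nonneg _) (norm_nonneg _)).1 h2

theorem ker_abs (T : E →L[ℂ] E) : (CFC.abs T).ker = T.ker := by
  ext x
  change CFC.abs T x = 0 ↔ T x = 0
  rw [← norm_eq_zero, norm_abs_apply, norm_eq_zero]

theorem closure_range_abs (T : E →L[ℂ] E) :
    (CFC.abs T).range.topologicalClosure = T.kerᗮ := by
  have hs : adjoint (CFC.abs T) = CFC.abs T := (CFC.abs_nonneg T).isSelfAdjoint
  have := closure_range_adjoint (CFC.abs T)
  rwa [hs, ker_abs] at this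

/-- Existence and uniqueness of the polar decomposition. -/
theorem existsUnique_isPolarFactor (T : E →L[ℂ] E) :
    ∃! U : E →L[ℂ] E, IsPolarFactor T U := by
  have hc : IsClosed (T.ker : Set E) := T.isClosed_ker
  have : CompleteSpace T.ker := hc.completeSpace_coe
  have hmem : ∀ x, CFC.abs T x ∈ T.kerᗮ := fun x => by
    rw [← closure_range_abs]
    exact Submodule.le_topologicalClosure _ ⟨x, rfl⟩
  let e : E →ₗ[ℂ] T.kerᗮ := (CFC.abs T).toLinearMap.codRestrict T.kerᗮ hmem
  have he : ∀ x, ((e x : T.kerᗮ) : E) = CFC.abs T x := fun x => rfl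
  have hdense : DenseRange e := by
    intro y
    have hy : (y : E) ∈ closure (Set.range (CFC.abs T : E →L[ℂ] E)) := by
      have h1 : (y : E) ∈ (CFC.abs T).range.topologicalClosure := by
        rw [closure_range_abs]
        exact y.2
      exact h1
    rw [closure_subtype]
    convert hy using 2
    ext z
    simp [he]
  have hnorm : ∀ x, ‖T.toLinearMap x‖ ≤ 1 * ‖e x‖ := fun x => by
    rw [one_mul, Submodule.coe_norm, he, norm_abs_apply]
    rfl
  let V : T.kerᗮ →L[ℂ] E := T.toLinearMap.extendOfNorm e
  have hV : ∀ x, V (e x) = T x := fun x =>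
    LinearMap.extendOfNorm_eq hdense ⟨1, hnorm⟩ x
  have hViso : ∀ y, ‖V y‖ = ‖y‖ := by
    intro y
    refine hdense.induction_on (p := fun y => ‖V y‖ = ‖y‖) y
      (isClosed_eq (by fun_prop) (by fun_prop)) ?_
    intro x
    rw [hV, Submodule.coe_norm, he, norm_abs_apply]
  have hfix : ∀ x (hx : x ∈ T.kerᗮ), (T.kerᗮ).orthogonalProjectionOnto x = ⟨x, hx⟩ := fun x hx =>
    Submodule.orthogonalProjectionOnto_mem_subspace_eq_self (⟨x, hx⟩ : T.kerᗮ)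
  let U : E →L[ℂ] E := V ∘L (T.kerᗮ).orthogonalProjectionOnto
  have hUker : U.ker = T.ker := by
    ext x
    change V ((T.kerᗮ).orthogonalProjectionOnto x) = 0 ↔ x ∈ T.ker
    rw [← norm_eq_zero, hViso, norm_eq_zero, Submodule.orthogonalProjectionOnto_eq_zero_iff,
      Submodule.orthogonal_orthogonal]
  refine ⟨U, ⟨?_, ?_, hUker⟩, ?_⟩
  · ext x
    change T x = V ((T.kerᗮ).orthogonalProjectionOnto (CFC.abs T x))
    rw [hfix _ (hmem x), ← hV x]
    rfl
  · intro x hx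
    rw [hUker] at hx
    change ‖V ((T.kerᗮ).orthogonalProjectionOnto x)‖ = ‖x‖
    rw [hViso, hfix x hx]
    rfl
  · intro W hW
    have h1 : ∀ y : T.kerᗮ, W y = V y := by
      intro y
      refine hdense.induction_on (p := fun y : T.kerᗮ => W y = V y) y
        (isClosed_eq (by fun_prop) (by fun_prop)) ?_
      intro x
      rw [hV, he]
      exact (congrArg (fun A : E →L[ℂ] E => A x) hW.eq).symm
    ext x
    have h2 : x - (T.kerᗮ).orthogonalProjectionOnto x ∈ W.ker := by
      rw [hW.ker_eq]
      have := Submodule.sub_starProjection_mem_orthogonal (K := T.kerᗮ) x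
      rwa [Submodule.orthogonal_orthogonal] at this
    have h3 : W (x - (T.kerᗮ).orthogonalProjectionOnto x) = 0 := h2
    rw [map_sub, sub_eq_zero] at h3
    rw [h3, h1]
    rfl

/-- The reduced solution of `Z = Y X`. -/
def reducedSolution (Y : F →L[ℂ] E) (Z : G →L[ℂ] E) (h : Z.range ≤ Y.range) : G →L[ℂ] F :=
  (existsUnique_isReducedSolution Y Z h).choose

theorem reducedSolution_spec (Y : F →L[ℂ] E) (Z : G →L[ℂ] E) (h : Z.range ≤ Y.range) :
    IsReducedSolution Y Z (reducedSolution Y Z h) :=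
  (existsUnique_isReducedSolution Y Z h).choose_spec.1

/-- The partial isometry in the polar decomposition of `T`. -/
def polarFactor (T : E →L[ℂ] E) : E →L[ℂ] E :=
  (existsUnique_isPolarFactor T).choose

theorem polarFactor_spec (T : E →L[ℂ] E) : IsPolarFactor T (polarFactor T) :=
  (existsUnique_isPolarFactor T).choose_spec.1

end Factorization

section Schur

variable {H : Type*} [NormedAddCommGroup H] [InnerProductSpace ℂ H] [CompleteSpace H]

/-- The entry `a : S → S` of the matrix of `B` with respect to `H = S ⊕ Sᗮ`. -/
def blockA (B : H →L[ℂ] H) (S : Submodule ℂ H) [CompleteSpace S] : S →L[ℂ] S :=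
  S.orthogonalProjectionOnto ∘L B ∘L S.subtypeL

/-- The entry `b : Sᗮ → S` of the matrix of `B` with respect to `H = S ⊕ Sᗮ`. -/
def blockB (B : H →L[ℂ] H) (S : Submodule ℂ H) [CompleteSpace S] : Sᗮ →L[ℂ] S :=
  S.orthogonalProjectionOnto ∘L B ∘L Sᗮ.subtypeL

/-- The entry `c : Sᗮ → Sᗮ` of the matrix of `B` with respect to `H = S ⊕ Sᗮ`. -/
def blockC (B : H →L[ℂ] H) (S : Submodule ℂ H) : Sᗮ →L[ℂ] Sᗮ :=
  Sᗮ.orthogonalProjectionOnto ∘L B ∘L Sᗮ.subtypeL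

/-- `B` is `S`-weakly complementable: `R(b) ⊆ R(|a|^{1/2})`. -/
def WeaklyComplementable (B : H →L[ℂ] H) (S : Submodule ℂ H) [CompleteSpace S] : Prop :=
  (blockB B S).range ≤ (sqrtAbs (blockA B S)).range

/-- The Schur complement `B_{/S}`: the operator on `H` whose only nonzero matrix entry with
respect to `H = S ⊕ Sᗮ` is `c - f* u f : Sᗮ → Sᗮ`, where `f` is the reduced solution of
`b = |a|^{1/2} x` and `a = u |a|` is the polar decomposition of `a`. -/
def schurComplement (B : H →L[ℂ] H) (S : Submodule ℂ H) [CompleteSpace S]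
    (h : WeaklyComplementable B S) : H →L[ℂ] H :=
  let f : Sᗮ →L[ℂ] S := reducedSolution (sqrtAbs (blockA B S)) (blockB B S) h
  let u : S →L[ℂ] S := polarFactor (blockA B S)
  Sᗮ.subtypeL ∘L (blockC B S - adjoint f ∘L u ∘L f) ∘L Sᗮ.orthogonalProjectionOnto

/-- `S = Sp ⊕_B Sm` with `Sp`, `Sm` closed, orthogonal and `B`-orthogonal, `Sp` being
`B`-nonnegative and `Sm` being `B`-nonpositive. -/
structure IsSignDecomposition (B : H →L[ℂ] H) (S Sp Sm : Submodule ℂ H) : Prop where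
  isClosed_pos : IsClosed (Sp : Set H)
  isClosed_neg : IsClosed (Sm : Set H)
  sup_eq : Sp ⊔ Sm = S
  orthogonal : ∀ s ∈ Sp, ∀ t ∈ Sm, ⟪s, t⟫_ℂ = 0
  orthogonal_form : ∀ s ∈ Sp, ∀ t ∈ Sm, ⟪B s, t⟫_ℂ = 0
  nonneg : ∀ s ∈ Sp, 0 ≤ (⟪B s, s⟫_ℂ).re
  nonpos : ∀ t ∈ Sm, (⟪B t, t⟫_ℂ).re ≤ 0

/-- The bounded (oblique) projections on `H` with nullspace `S`. -/
def projWithKer (S : Submodule ℂ H) : Set (H →L[ℂ] H) :=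
  {Q | Q ∘L Q = Q ∧ Q.ker = S}

/-- `X` is the iterated extremum
`sup_{Q₋, N(Q₋) = Sm} (inf_{Q₊, N(Q₊) = Sp} Q₋* Q₊* B Q₊ Q₋)` in the Loewner order:
the infimum exists for every `Q₋`, and the supremum of these infima exists and equals `X`. -/
def IsSupInf (B : H →L[ℂ] H) (Sp Sm : Submodule ℂ H) (X : H →L[ℂ] H) : Prop :=
  ∃ T : projWithKer Sm → (H →L[ℂ] H),
    (∀ Qm : projWithKer Sm, IsGLB
      {Y | ∃ Qp ∈ projWithKer Sp,
        Y = adjoint Qm.1 ∘L adjoint Qp ∘L B ∘L Qp ∘L Qm.1} (T Qm)) ∧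
    IsLUB (Set.range T) X

/-- `X` is the iterated extremum
`inf_{Q₊, N(Q₊) = Sp} (sup_{Q₋, N(Q₋) = Sm} Q₊* Q₋* B Q₋ Q₊)` in the Loewner order:
the supremum exists for every `Q₊`, and the infimum of these suprema exists and equals `X`. -/
def IsInfSup (B : H →L[ℂ] H) (Sp Sm : Submodule ℂ H) (X : H →L[ℂ] H) : Prop :=
  ∃ T : projWithKer Sp → (H →L[ℂ] H),
    (∀ Qp : projWithKer Sp, IsLUB
      {Y | ∃ Qm ∈ projWithKer Sm,
        Y = adjoint Qp.1 ∘L adjoint Qm ∘L B ∘L Qm ∘L Qp.1} (T Qp)) ∧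
    IsGLB (Set.range T) X

end Schur

end

end SchurMinMax

namespace SchurMinMax

/-! ### Loewner order and quadratic forms. -/

section Order

/-! Write A = |a|^{1/2}, let P be the orthogonal projection of S onto Sp, and J = P - (1 - P). The
sign hypotheses make P commute with a and give |a| = J a, hence a = A J A, and the polar factor u
agrees with J on the closure of R(A). If b = A f, completing the square gives, for z with components
s in S and y in Sᗮ, ⟪B z, z⟫ = ⟪K z, z⟫ + ‖P (A s + f y)‖² - ‖(1 - P)(A s - f y)‖², where K is the
Schur complement. A projection with nullspace M moves vectors only along M, and some such projection
takes a given vector outside M to any chosen point of its coset. K does not see S, the first square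
does not see Sm and the second does not see Sp; since f y lies in the closure of R(A), each square
becomes arbitrarily small by moving along its own subspace. So the infimum deletes the first square
and the supremum the second, in either order (`isSupInf_of_form_eq`).

Conversely, the inner infimum at the single projection 1 - P_{Sm} bounds the form of B below on
every coset x + Sp with x in Sᗮ. A discriminant argument turns this into |⟪B x, s⟫|² ≤ C ‖x‖² ⟪B s,
s⟫ for s in Sp (`IsSupInf.exists_norm_inner_sq_le`). With the same bound for -B on Sm, ‖b* s‖ is at
most a constant times ‖A s‖, and Douglas' lemma concludes. -/

theorem re_inner_le_of_le {H : Type*} [NormedAddCommGroup H] [InnerProductSpace ℂ H]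
    {X Y : H →L[ℂ] H} (h : X ≤ Y) (x : H) :
    (⟪X x, x⟫_ℂ).re ≤ (⟪Y x, x⟫_ℂ).re := by
  have := ((le_def X Y).1 h).re_inner_nonneg_left x
  simpa [inner_sub_left] using this

variable {H : Type*} [NormedAddCommGroup H] [InnerProductSpace ℂ H] [CompleteSpace H]

theorem le_of_re_inner_le {X Y : H →L[ℂ] H} (hX : IsSelfAdjoint X) (hY : IsSelfAdjoint Y)
    (h : ∀ x, (⟪X x, x⟫_ℂ).re ≤ (⟪Y x, x⟫_ℂ).re) : X ≤ Y := by
  rw [le_def, isPositive_def']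
  refine ⟨hY.sub hX, fun x => ?_⟩
  have := h x
  simp only [reApplyInnerSelf_apply, sub_apply, inner_sub_left]
  simpa using this

/-- Competing bounds range over all bounded operators, so their selfadjointness has to be recovered
from the positivity of the difference. -/
theorem isSelfAdjoint_of_le_right {X Y : H →L[ℂ] H} (hY : IsSelfAdjoint Y) (h : X ≤ Y) :
    IsSelfAdjoint X := by
  have := hY.sub ((le_def X Y).1 h).isSelfAdjoint
  simpa using this

theorem isSelfAdjoint_of_le_left {X Y : H →L[ℂ] H} (hX : IsSelfAdjoint X) (h : X ≤ Y) :
    IsSelfAdjoint Y := by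
  have := hX.add ((le_def X Y).1 h).isSelfAdjoint
  simpa using this

/-- A pointwise infimum of quadratic forms that is the form of a selfadjoint operator is the
infimum in the Loewner order. -/
theorem isGLB_of_forall_re_inner {A : Set (H →L[ℂ] H)} {T : H →L[ℂ] H} (hA : A.Nonempty)
    (hsa : ∀ Y ∈ A, IsSelfAdjoint Y) (hT : IsSelfAdjoint T)
    (hle : ∀ Y ∈ A, ∀ x, (⟪T x, x⟫_ℂ).re ≤ (⟪Y x, x⟫_ℂ).re)
    (happrox : ∀ x, ∀ ε > 0, ∃ Y ∈ A, (⟪Y x, x⟫_ℂ).re ≤ (⟪T x, x⟫_ℂ).re + ε) : IsGLB A T := by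
  refine ⟨fun Y hY => le_of_re_inner_le hT (hsa Y hY) (hle Y hY), fun X hX => ?_⟩
  obtain ⟨Y, hY⟩ := hA
  refine le_of_re_inner_le (isSelfAdjoint_of_le_right (hsa Y hY) (hX hY)) hT fun x => ?_
  refine le_of_forall_pos_le_add fun ε hε => ?_
  obtain ⟨Z, hZ, h⟩ := happrox x ε hε
  exact (re_inner_le_of_le (hX hZ) x).trans h

/-- A pointwise supremum of quadratic forms that is the form of a selfadjoint operator is the
supremum in the Loewner order. -/
theorem isLUB_of_forall_re_inner {A : Set (H →L[ℂ] H)} {T : H →L[ℂ] H} (hA : A.Nonempty)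
    (hsa : ∀ Y ∈ A, IsSelfAdjoint Y) (hT : IsSelfAdjoint T)
    (hle : ∀ Y ∈ A, ∀ x, (⟪Y x, x⟫_ℂ).re ≤ (⟪T x, x⟫_ℂ).re)
    (happrox : ∀ x, ∀ ε > 0, ∃ Y ∈ A, (⟪T x, x⟫_ℂ).re ≤ (⟪Y x, x⟫_ℂ).re + ε) : IsLUB A T := by
  refine ⟨fun Y hY => le_of_re_inner_le (hsa Y hY) hT (hle Y hY), fun X hX => ?_⟩
  obtain ⟨Y, hY⟩ := hA
  refine le_of_re_inner_le hT (isSelfAdjoint_of_le_left (hsa Y hY) (hX hY)) fun x => ?_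
  refine le_of_forall_pos_le_add fun ε hε => ?_
  obtain ⟨Z, hZ, h⟩ := happrox x ε hε
  exact h.trans (by linarith [re_inner_le_of_le (hX hZ) x])

end Order

/-! ### Oblique projections with prescribed nullspace. -/

section Projections

variable {H : Type*} [NormedAddCommGroup H] [InnerProductSpace ℂ H]

theorem sub_mem_of_mem_projWithKer {M : Submodule ℂ H} {Q : H →L[ℂ] H}
    (hQ : Q ∈ projWithKer M) (x : H) : Q x - x ∈ M := by
  have h := congrArg (fun A : H →L[ℂ] H => A x) hQ.1
  rw [← hQ.2]
  simpa [sub_eq_zero] using h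

theorem apply_eq_zero_of_mem_projWithKer {M : Submodule ℂ H} {Q : H →L[ℂ] H}
    (hQ : Q ∈ projWithKer M) {x : H} (hx : x ∈ M) : Q x = 0 := by
  rw [← hQ.2] at hx
  exact hx

/-- Since 1 - P_M kills R(G), it is unchanged by inserting 1 + G; this gives both idempotency and
the nullspace. -/
theorem one_add_comp_mem_projWithKer (M : Submodule ℂ H) [M.HasOrthogonalProjection]
    (G : H →L[ℂ] H) (hG : ∀ x, G x ∈ M) :
    (1 + G) ∘L (1 - M.starProjection) ∈ projWithKer M := by
  have key : ∀ x, (1 - M.starProjection) (((1 + G) ∘L (1 - M.starProjection)) x)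
      = (1 - M.starProjection) x := by
    intro x
    have h2 : M.starProjection (M.starProjection x) = M.starProjection x :=
      Submodule.starProjection_eq_self_iff.2 (Submodule.starProjection_apply_mem M x)
    have h1 : ∀ y, M.starProjection (G y) = G y := fun y =>
      Submodule.starProjection_eq_self_iff.2 (hG y)
    simp only [comp_apply, add_apply, sub_apply, one_apply_eq_self, map_add, map_sub, h1, h2]
    abel
  refine ⟨?_, ?_⟩
  · ext x
    exact congrArg (1 + G : H →L[ℂ] H) (key x)
  · ext x
    change ((1 + G) ∘L (1 - M.starProjection)) x = 0 ↔ x ∈ M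
    constructor
    · intro hx
      have := key x
      rw [hx, map_zero] at this
      have h3 : x - M.starProjection x = 0 := this.symm
      rw [sub_eq_zero.1 h3]
      exact Submodule.starProjection_apply_mem M x
    · intro hx
      have h3 : (1 - M.starProjection) x = 0 :=
        sub_eq_zero.2 (Submodule.starProjection_eq_self_iff.2 hx).symm
      rw [comp_apply, h3, map_zero]

theorem one_sub_starProjection_mem_projWithKer (M : Submodule ℂ H) [M.HasOrthogonalProjection] :
    1 - M.starProjection ∈ projWithKer M := by
  have := one_add_comp_mem_projWithKer M 0 (by simp)
  rwa [add_zero] at this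

/-- A vector outside `M` can be moved anywhere in its coset modulo `M` by a projection with
nullspace `M`. -/
theorem exists_mem_projWithKer_apply_eq (M : Submodule ℂ H) [M.HasOrthogonalProjection] {x m : H}
    (hx : x ∉ M) (hm : m ∈ M) : ∃ Q ∈ projWithKer M, Q x = x + m := by
  set w := x - M.starProjection x with hw
  have hw0 : w ≠ 0 := fun h => hx <| by
    rw [sub_eq_zero.1 h]
    exact Submodule.starProjection_apply_mem M x
  -- Rank one: G sends w = (1 - P_M) x to P_M x + m, so that (1 + G) w = x + m.
  let G : H →L[ℂ] H :=
    ((⟪w, w⟫_ℂ)⁻¹ • innerSL ℂ w).smulRight (M.starProjection x + m)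
  have hG : ∀ y, G y ∈ M := fun y =>
    M.smul_mem _ (M.add_mem (Submodule.starProjection_apply_mem M x) hm)
  refine ⟨_, one_add_comp_mem_projWithKer M G hG, ?_⟩
  have hGw : G w = M.starProjection x + m := by
    have : ⟪w, w⟫_ℂ ≠ 0 := inner_self_ne_zero.2 hw0
    change ((⟪w, w⟫_ℂ)⁻¹ * ⟪w, w⟫_ℂ) • (M.starProjection x + m) = _
    rw [inv_mul_cancel₀ this, one_smul]
  change w + G w = x + m
  rw [hGw, hw]
  abel

end Projections

/-! ### The iterated extremum of a form with two independent squares. -/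

section Saddle

variable {H E F : Type*} [NormedAddCommGroup H] [InnerProductSpace ℂ H] [CompleteSpace H]
  [NormedAddCommGroup E] [InnerProductSpace ℂ E]
  [NormedAddCommGroup F] [InnerProductSpace ℂ F] [CompleteSpace F]

theorem isSelfAdjoint_adjoint_comp_comp {B : H →L[ℂ] H} (hB : IsSelfAdjoint B) (Q : H →L[ℂ] H) :
    IsSelfAdjoint (adjoint Q ∘L B ∘L Q) :=
  hB.adjoint_conj Q

theorem re_inner_add_of_apply_eq_zero {K : H →L[ℂ] H} (hK : IsSelfAdjoint K) {m : H}
    (hm : K m = 0) (x : H) : (⟪K (x + m), x + m⟫_ℂ).re = (⟪K x, x⟫_ℂ).re := by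
  have h : ⟪K x, m⟫_ℂ = ⟪x, K m⟫_ℂ := hK.isSymmetric x m
  rw [map_add, hm, add_zero, inner_add_right, h, hm, inner_zero_right, add_zero]

/-- If the form of `B` is that of `K` plus `‖Lp ·‖²` minus `‖Lm ·‖²`, and the two squares can be
made arbitrarily small independently by moving along `Sp` and `Sm`, then the iterated
supremum-infimum is `K`. -/
theorem isSupInf_of_form_eq {B K : H →L[ℂ] H} (hB : IsSelfAdjoint B) (hK : IsSelfAdjoint K)
    {Sp Sm : Submodule ℂ H} [Sp.HasOrthogonalProjection] [Sm.HasOrthogonalProjection]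
    (Lp : H →L[ℂ] E) (Lm : H →L[ℂ] F)
    (hform : ∀ z, (⟪B z, z⟫_ℂ).re = (⟪K z, z⟫_ℂ).re + ‖Lp z‖ ^ 2 - ‖Lm z‖ ^ 2)
    (hKp : ∀ s ∈ Sp, K s = 0) (hKm : ∀ t ∈ Sm, K t = 0)
    (hLm : ∀ s ∈ Sp, Lm s = 0)
    (hpa : ∀ z, ∀ ε > 0, ∃ s ∈ Sp, ‖Lp (z + s)‖ ^ 2 ≤ ε)
    (hma : ∀ z, ∀ ε > 0, ∃ t ∈ Sm, ‖Lm (z + t)‖ ^ 2 ≤ ε) :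
    IsSupInf B Sp Sm K := by
  have hK1 : IsSelfAdjoint (K - adjoint Lm ∘L Lm) :=
    hK.sub (isPositive_adjoint_comp_self Lm).isSelfAdjoint
  have hT : ∀ (Q : H →L[ℂ] H) (x : H),
      (⟪(adjoint Q ∘L (K - adjoint Lm ∘L Lm) ∘L Q) x, x⟫_ℂ).re =
        (⟪K (Q x), Q x⟫_ℂ).re - ‖Lm (Q x)‖ ^ 2 := by
    intro Q x
    have h1 := apply_norm_sq_eq_inner_adjoint_left Lm (Q x)
    rw [h1]
    simp [adjoint_inner_left]
  have hform' : ∀ Qm : H →L[ℂ] H, ∀ Qp ∈ projWithKer Sp, ∀ x : H,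
      (⟪(adjoint Qm ∘L adjoint Qp ∘L B ∘L Qp ∘L Qm) x, x⟫_ℂ).re =
        (⟪K (Qm x), Qm x⟫_ℂ).re - ‖Lm (Qm x)‖ ^ 2 + ‖Lp (Qp (Qm x))‖ ^ 2 := by
    intro Qm Qp hQp x
    have h0 : Qp (Qm x) = Qm x + (Qp (Qm x) - Qm x) := by abel
    have h1 := sub_mem_of_mem_projWithKer hQp (Qm x)
    have h2 : (⟪K (Qp (Qm x)), Qp (Qm x)⟫_ℂ).re = (⟪K (Qm x), Qm x⟫_ℂ).re := by
      rw [h0]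
      exact re_inner_add_of_apply_eq_zero hK (hKp _ h1) _
    have h3 : Lm (Qp (Qm x)) = Lm (Qm x) := by
      rw [h0, map_add, hLm _ h1, add_zero]
    have h4 := hform (Qp (Qm x))
    rw [h2, h3] at h4
    simp only [comp_apply, adjoint_inner_left]
    rw [h4]
    ring
  have hKQ : ∀ Q ∈ projWithKer Sm, ∀ x, (⟪K (Q x), Q x⟫_ℂ).re = (⟪K x, x⟫_ℂ).re := by
    intro Q hQ x
    have h0 : Q x = x + (Q x - x) := by abel
    rw [h0]
    exact re_inner_add_of_apply_eq_zero hK (hKm _ (sub_mem_of_mem_projWithKer hQ x)) _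
  -- The inner infimum removes the `Lp` square only; the outer supremum then removes the `Lm`
  -- square.
  refine ⟨fun Q => adjoint Q.1 ∘L (K - adjoint Lm ∘L Lm) ∘L Q.1, fun Q => ?_, ?_⟩
  · apply isGLB_of_forall_re_inner
    · exact ⟨_, _, one_sub_starProjection_mem_projWithKer Sp, rfl⟩
    · rintro _ ⟨Qp, -, rfl⟩
      exact isSelfAdjoint_adjoint_comp_comp (isSelfAdjoint_adjoint_comp_comp hB Qp) Q.1
    · exact isSelfAdjoint_adjoint_comp_comp hK1 Q.1
    · rintro _ ⟨Qp, hQp, rfl⟩ x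
      rw [hT, hform' _ _ hQp]
      nlinarith [sq_nonneg ‖Lp (Qp (Q.1 x))‖]
    · intro x ε hε
      have : ∃ Qp ∈ projWithKer Sp, ‖Lp (Qp (Q.1 x))‖ ^ 2 ≤ ε := by
        -- A vector of Sp cannot be moved, but it is sent to 0, where the square vanishes.
        by_cases hx : Q.1 x ∈ Sp
        · refine ⟨_, one_sub_starProjection_mem_projWithKer Sp, ?_⟩
          rw [apply_eq_zero_of_mem_projWithKer (one_sub_starProjection_mem_projWithKer Sp) hx]
          simpa using hε.le
        · obtain ⟨s, hs, h⟩ := hpa (Q.1 x) ε hε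
          obtain ⟨Qp, hQp, hq⟩ := exists_mem_projWithKer_apply_eq Sp hx hs
          exact ⟨Qp, hQp, by rwa [hq]⟩
      obtain ⟨Qp, hQp, h⟩ := this
      refine ⟨_, ⟨Qp, hQp, rfl⟩, ?_⟩
      rw [hT, hform' _ _ hQp]
      linarith
  · apply isLUB_of_forall_re_inner
    · exact ⟨_, ⟨_, one_sub_starProjection_mem_projWithKer Sm⟩, rfl⟩
    · rintro _ ⟨Q, rfl⟩
      exact isSelfAdjoint_adjoint_comp_comp hK1 Q.1
    · exact hK
    · rintro _ ⟨Q, rfl⟩ x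
      beta_reduce
      rw [hT, hKQ _ Q.2]
      nlinarith [sq_nonneg ‖Lm (Q.1 x)‖]
    · intro x ε hε
      have : ∃ Q ∈ projWithKer Sm, ‖Lm (Q x)‖ ^ 2 ≤ ε := by
        by_cases hx : x ∈ Sm
        · refine ⟨_, one_sub_starProjection_mem_projWithKer Sm, ?_⟩
          rw [apply_eq_zero_of_mem_projWithKer (one_sub_starProjection_mem_projWithKer Sm) hx]
          simpa using hε.le
        · obtain ⟨s, hs, h⟩ := hma x ε hε
          obtain ⟨Q, hQ, hq⟩ := exists_mem_projWithKer_apply_eq Sm hx hs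
          exact ⟨Q, hQ, by rwa [hq]⟩
      obtain ⟨Q, hQ, h⟩ := this
      refine ⟨_, ⟨⟨Q, hQ⟩, rfl⟩, ?_⟩
      beta_reduce
      rw [hT, hKQ _ hQ]
      linarith

theorem isGLB_neg_image {A : Set (H →L[ℂ] H)} {T : H →L[ℂ] H} (h : IsLUB A T) :
    IsGLB {Y | -Y ∈ A} (-T) :=
  ⟨fun _ hY => neg_le.1 (h.1 hY),
    fun X hX => le_neg.1 (h.2 fun Y hY => le_neg.1 (hX (by simpa using hY)))⟩

theorem isLUB_neg_image {A : Set (H →L[ℂ] H)} {T : H →L[ℂ] H} (h : IsGLB A T) :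
    IsLUB {Y | -Y ∈ A} (-T) :=
  ⟨fun _ hY => le_neg.1 (h.1 hY),
    fun X hX => neg_le.1 (h.2 fun Y hY => neg_le.1 (hX (by simpa using hY)))⟩

/-- Negation exchanges suprema with infima and Sp with Sm, so the inf-sup statements reduce to
sup-inf statements for -B. -/
theorem IsSupInf.neg {B : H →L[ℂ] H} {Sp Sm : Submodule ℂ H} {X : H →L[ℂ] H}
    (h : IsSupInf B Sp Sm X) : IsInfSup (-B) Sm Sp (-X) := by
  obtain ⟨T, hT, hX⟩ := h
  refine ⟨fun Q => -T Q, fun Q => ?_, ?_⟩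
  · convert isLUB_neg_image (hT Q) using 1
    ext Y
    simp [neg_eq_iff_eq_neg]
  · convert isGLB_neg_image hX using 1
    ext Y
    simp [eq_neg_iff_add_eq_zero, neg_eq_iff_add_eq_zero]

theorem IsInfSup.neg {B : H →L[ℂ] H} {Sp Sm : Submodule ℂ H} {X : H →L[ℂ] H}
    (h : IsInfSup B Sp Sm X) : IsSupInf (-B) Sm Sp (-X) := by
  obtain ⟨T, hT, hX⟩ := h
  refine ⟨fun Q => -T Q, fun Q => ?_, ?_⟩
  · convert isGLB_neg_image (hT Q) using 1
    ext Y
    simp [neg_eq_iff_eq_neg]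
  · convert isLUB_neg_image hX using 1
    ext Y
    simp [eq_neg_iff_add_eq_zero, neg_eq_iff_add_eq_zero]

end Saddle

/-! ### Douglas majorization, and square roots and polar factors of sign-split operators. -/

section SignCommuting

variable {E F G : Type*}
  [NormedAddCommGroup E] [InnerProductSpace ℂ E] [CompleteSpace E]
  [NormedAddCommGroup F] [InnerProductSpace ℂ F] [CompleteSpace F]
  [NormedAddCommGroup G] [InnerProductSpace ℂ G] [CompleteSpace G]

/-- Douglas' lemma: majorization of the adjoints implies range inclusion. -/
theorem range_le_range_of_norm_adjoint_le (Y : F →L[ℂ] E) (Z : G →L[ℂ] E) (C : ℝ)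
    (h : ∀ x, ‖adjoint Z x‖ ≤ C * ‖adjoint Y x‖) : Z.range ≤ Y.range := by
  let M := (adjoint Y).range.topologicalClosure
  have hM : IsClosed (M : Set F) := Submodule.isClosed_topologicalClosure _
  have : CompleteSpace M := hM.completeSpace_coe
  have hmem : ∀ x, adjoint Y x ∈ M := fun x => Submodule.le_topologicalClosure _ ⟨x, rfl⟩
  let e : E →ₗ[ℂ] M := (adjoint Y).toLinearMap.codRestrict M hmem
  have hdense : DenseRange e := by
    intro y
    have hy : (y : F) ∈ closure (Set.range (adjoint Y)) := y.2
    rw [closure_subtype]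
    convert hy using 2
    ext z
    simp [e]
  -- The majorization makes Y* x ↦ Z* x well defined and bounded; its extension W gives Z = Y W*.
  let V : M →L[ℂ] G := (adjoint Z).toLinearMap.extendOfNorm e
  have hV : ∀ x, V (e x) = adjoint Z x := fun x =>
    LinearMap.extendOfNorm_eq hdense ⟨C, h⟩ x
  let W : F →L[ℂ] G := V ∘L M.orthogonalProjectionOnto
  have hW : W ∘L adjoint Y = adjoint Z := by
    ext x
    rw [← hV x]
    change V (M.orthogonalProjectionOnto (adjoint Y x)) = V (e x)
    exact congrArg V (Submodule.orthogonalProjectionOnto_mem_subspace_eq_self (e x))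
  have hZ : Z = Y ∘L adjoint W := by
    have := congrArg adjoint hW
    rw [adjoint_comp, adjoint_adjoint, adjoint_adjoint] at this
    exact this.symm
  rintro _ ⟨x, rfl⟩
  exact ⟨adjoint W x, (congrArg (fun A : G →L[ℂ] E => A x) hZ).symm⟩

theorem inner_apply_of_isStarProjection {P : E →L[ℂ] E} (hP : IsStarProjection P) (x y : E) :
    ⟪P x, P y⟫_ℂ = ⟪P x, y⟫_ℂ := by
  have h1 : ⟪P (P x), y⟫_ℂ = ⟪P x, P y⟫_ℂ := hP.isSelfAdjoint.isSymmetric _ _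
  rw [← h1]
  exact congrArg (fun A : E →L[ℂ] E => ⟪A x, y⟫_ℂ) hP.isIdempotentElem.eq

theorem norm_apply_le_of_isStarProjection {P : E →L[ℂ] E} (hP : IsStarProjection P) (x : E) :
    ‖P x‖ ≤ ‖x‖ := by
  have h2 : ‖P x‖ ^ 2 ≤ ‖P x‖ * ‖x‖ := by
    rw [← inner_self_eq_norm_sq (𝕜 := ℂ), inner_apply_of_isStarProjection hP]
    exact re_inner_le_norm _ _
  nlinarith [norm_nonneg (P x), norm_nonneg x]

variable {a P : E →L[ℂ] E}

theorem re_inner_sign_mul (hP : IsStarProjection P) (hc : Commute P a) (x : E) :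
    (⟪((P - (1 - P)) * a) x, x⟫_ℂ).re =
      (⟪a (P x), P x⟫_ℂ).re - (⟪a ((1 - P) x), (1 - P) x⟫_ℂ).re := by
  have key : ∀ R : E →L[ℂ] E, IsStarProjection R → Commute R a →
      ⟪a (R x), R x⟫_ℂ = ⟪R (a x), x⟫_ℂ := by
    intro R hR hRa
    have h : R (a x) = a (R x) := congrArg (fun A : E →L[ℂ] E => A x) hRa.eq
    rw [← h, inner_apply_of_isStarProjection hR]
  rw [key P hP hc, key (1 - P) hP.one_sub ((Commute.one_left a).sub_left hc), ← Complex.sub_re,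
    ← inner_sub_left]
  rfl

theorem sign_mul_sign (hP : IsStarProjection P) : (P - (1 - P)) * (P - (1 - P)) = 1 := by
  have h : P * P = P := hP.isIdempotentElem.eq
  simp only [mul_sub, sub_mul, one_mul, mul_one, h]
  abel

theorem isSelfAdjoint_sign (hP : IsStarProjection P) : IsSelfAdjoint (P - (1 - P)) :=
  hP.isSelfAdjoint.sub hP.one_sub.isSelfAdjoint

/-- An invariant subspace of a selfadjoint operator is reducing: take adjoints in a P = P a P. -/
theorem commute_of_one_sub_mul_mul_eq_zero (ha : IsSelfAdjoint a) (hP : IsStarProjection P)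
    (h : (1 - P) * a * P = 0) : Commute P a := by
  have h1 : a * P = P * a * P := by
    rwa [sub_mul, one_mul, sub_mul, sub_eq_zero] at h
  have h2 := congrArg star h1
  rw [star_mul, star_mul, star_mul, ha.star_eq, hP.isSelfAdjoint.star_eq, ← mul_assoc] at h2
  exact h2.trans h1.symm

/-- `P` is an orthogonal projection reducing the selfadjoint operator `a`, with `a` nonnegative on
the range of `P` and nonpositive on its nullspace. -/
structure IsSignProjection (a P : E →L[ℂ] E) : Prop where
  isSelfAdjoint : IsSelfAdjoint a
  isStarProjection : IsStarProjection P
  commute : Commute P a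
  nonneg : ∀ x, 0 ≤ (⟪a (P x), P x⟫_ℂ).re
  nonpos : ∀ x, (⟪a ((1 - P) x), (1 - P) x⟫_ℂ).re ≤ 0

/-- J a is positive with square a* a, because J² = 1 and J commutes with a; positive square roots
are unique. -/
theorem IsSignProjection.abs_eq (h : IsSignProjection a P) :
    CFC.abs a = (P - (1 - P)) * a := by
  obtain ⟨ha, hP, hc, hpos, hneg⟩ := h
  have hJ : Commute (P - (1 - P)) a := hc.sub_left ((Commute.one_left a).sub_left hc)
  have hJs := isSelfAdjoint_sign hP
  refine CFC.sqrt_unique ?_ ?_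
  · rw [ha.star_eq, hJ.eq, mul_assoc, ← hJ.eq, ← mul_assoc _ _ a, sign_mul_sign hP, one_mul]
  · rw [nonneg_iff_isPositive, isPositive_def']
    refine ⟨(IsSelfAdjoint.commute_iff hJs ha).1 hJ, fun x => ?_⟩
    rw [reApplyInnerSelf_apply]
    have := re_inner_sign_mul hP hc x
    have h1 := hpos x
    have h2 := hneg x
    change 0 ≤ (⟪((P - (1 - P)) * a) x, x⟫_ℂ).re
    linarith

theorem isSelfAdjoint_sqrtAbs (a : E →L[ℂ] E) : IsSelfAdjoint (sqrtAbs a) :=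
  (CFC.sqrt_nonneg _).isSelfAdjoint

theorem sqrtAbs_mul_self (a : E →L[ℂ] E) : sqrtAbs a * sqrtAbs a = CFC.abs a :=
  CFC.sqrt_mul_sqrt_self _ (CFC.abs_nonneg a)

theorem norm_sqrtAbs_sq (a : E →L[ℂ] E) (x : E) :
    ‖sqrtAbs a x‖ ^ 2 = (⟪CFC.abs a x, x⟫_ℂ).re := by
  have h : ⟪sqrtAbs a (sqrtAbs a x), x⟫_ℂ = ⟪sqrtAbs a x, sqrtAbs a x⟫_ℂ :=
    (isSelfAdjoint_sqrtAbs a).isSymmetric _ _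
  rw [← sqrtAbs_mul_self, mul_apply_eq_comp, h, ← inner_self_eq_norm_sq (𝕜 := ℂ)]
  rfl

theorem ker_sqrtAbs (a : E →L[ℂ] E) : (sqrtAbs a).ker = a.ker := by
  rw [← ker_abs a]
  ext x
  change sqrtAbs a x = 0 ↔ CFC.abs a x = 0
  constructor <;> intro h
  · rw [← sqrtAbs_mul_self, mul_apply_eq_comp, h, map_zero]
  · have := norm_sqrtAbs_sq a x
    rw [h, inner_zero_left] at this
    simpa using this

theorem IsSignProjection.commute_sqrtAbs (h : IsSignProjection a P) :
    Commute P (sqrtAbs a) := by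
  have h1 : Commute (CFC.abs a) P :=
    Commute.cfcₙ_nnreal
      (by rw [h.isSelfAdjoint.star_eq]; exact h.commute.symm.mul_left h.commute.symm) _
  exact (Commute.cfcₙ_nnreal h1 _).symm

theorem IsSignProjection.eq_sqrtAbs_mul (h : IsSignProjection a P) :
    a = sqrtAbs a * ((P - (1 - P)) * sqrtAbs a) := by
  have hc := h.commute_sqrtAbs
  rw [← mul_assoc, ← (hc.sub_left ((Commute.one_left _).sub_left hc)).eq, mul_assoc,
    sqrtAbs_mul_self, h.abs_eq, ← mul_assoc, sign_mul_sign h.isStarProjection, one_mul]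

theorem IsSignProjection.norm_sqrtAbs_sq (h : IsSignProjection a P) (x : E) :
    ‖sqrtAbs a x‖ ^ 2 = (⟪a (P x), P x⟫_ℂ).re - (⟪a ((1 - P) x), (1 - P) x⟫_ℂ).re := by
  rw [SchurMinMax.norm_sqrtAbs_sq, h.abs_eq, re_inner_sign_mul h.isStarProjection h.commute]

/-- Both u and J send |a| x to a x, so they agree on the closure of R(|a|). The restriction matters:
u vanishes on N(a), where J is isometric. -/
theorem IsSignProjection.polarFactor_apply (h : IsSignProjection a P) {v : E}
    (hv : v ∈ (sqrtAbs a).range.topologicalClosure) :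
    polarFactor a v = (P - (1 - P)) v := by
  have h1 : (sqrtAbs a).range.topologicalClosure = (CFC.abs a).range.topologicalClosure := by
    have := closure_range_adjoint (sqrtAbs a)
    rwa [(isSelfAdjoint_sqrtAbs a).adjoint_eq, ker_sqrtAbs, ← closure_range_abs] at this
  rw [h1] at hv
  have hcl : IsClosed {w : E | polarFactor a w = (P - (1 - P)) w} :=
    isClosed_eq (by fun_prop) (by fun_prop)
  refine closure_minimal ?_ hcl hv
  rintro _ ⟨x, rfl⟩
  have h2 : polarFactor a (CFC.abs a x) = a x :=
    (congrArg (fun A : E →L[ℂ] E => A x) (polarFactor_spec a).eq).symm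
  have h3 : (P - (1 - P)) (CFC.abs a x) = a x := by
    rw [h.abs_eq, ← mul_apply_eq_comp, ← mul_assoc, sign_mul_sign h.isStarProjection, one_mul]
  exact h2.trans h3.symm

/-- Approximate v by A s. As R A R = R A, correcting by a vector of R(R) cancels R v as well as
correcting by s itself. -/
theorem exists_norm_apply_add_sq_le {R A : E →L[ℂ] E} (hR : IsStarProjection R)
    (hc : Commute R A) {v : E} (hv : v ∈ A.range.topologicalClosure) {ε : ℝ} (hε : 0 < ε) :
    ∃ s, ‖R (v + A (R s))‖ ^ 2 ≤ ε := by
  obtain ⟨_, ⟨s, rfl⟩, hs⟩ := Metric.mem_closure_iff.1 hv (√ε) (Real.sqrt_pos.2 hε)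
  refine ⟨-s, ?_⟩
  have h1 : R (A (R (-s))) = R (A (-s)) := by
    have h2 : R * A * R = R * A := by
      rw [mul_assoc, ← hc.eq, ← mul_assoc, hR.isIdempotentElem.eq]
    exact congrArg (fun T : E →L[ℂ] E => T (-s)) h2
  have h3 : ‖R (v + A (R (-s)))‖ ≤ √ε := by
    rw [map_add, h1, ← map_add, map_neg, ← sub_eq_add_neg]
    refine (norm_apply_le_of_isStarProjection hR _).trans ?_
    rw [← dist_eq_norm]
    exact hs.le
  calc _ ≤ √ε ^ 2 := by gcongr
    _ = ε := Real.sq_sqrt hε.le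

/-- Completing the square for the indefinite form J: the sign of w flips where J = -1, so the cross
terms add up to the full inner product. -/
theorem norm_sq_sub_norm_sq_eq (hP : IsStarProjection P) (v w : E) :
    ‖P (v + w)‖ ^ 2 - ‖(1 - P) (v - w)‖ ^ 2 =
      (⟪(P - (1 - P)) v, v⟫_ℂ).re + (⟪(P - (1 - P)) w, w⟫_ℂ).re + 2 * (⟪w, v⟫_ℂ).re := by
  have key : ∀ R : E →L[ℂ] E, IsStarProjection R → ∀ y, ‖R y‖ ^ 2 = (⟪R y, y⟫_ℂ).re := by
    intro R hR y
    rw [← inner_self_eq_norm_sq (𝕜 := ℂ), inner_apply_of_isStarProjection hR]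
    rfl
  have hsymm : (⟪P v, w⟫_ℂ).re = (⟪P w, v⟫_ℂ).re := by
    have h1 : ⟪P v, w⟫_ℂ = ⟪v, P w⟫_ℂ := hP.isSelfAdjoint.isSymmetric _ _
    rw [h1]
    exact inner_re_symm (𝕜 := ℂ) _ _
  have hsymm' : (⟪v, w⟫_ℂ).re = (⟪w, v⟫_ℂ).re := inner_re_symm (𝕜 := ℂ) _ _
  rw [key P hP, key _ hP.one_sub]
  simp only [sub_apply, one_apply_eq_self, map_add, map_sub, inner_add_left, inner_add_right,
    inner_sub_left, inner_sub_right, Complex.add_re, Complex.sub_re]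
  linarith

end SignCommuting

/-! ### Matrix entries and the projection of S onto Sp. -/

section Blocks

variable {H : Type*} [NormedAddCommGroup H] [InnerProductSpace ℂ H]
  {B : H →L[ℂ] H} {S Sp Sm : Submodule ℂ H} [CompleteSpace S]

theorem inner_blockA (B : H →L[ℂ] H) (s t : S) : ⟪blockA B S s, t⟫_ℂ = ⟪B s, (t : H)⟫_ℂ :=
  S.inner_orthogonalProjectionOnto_eq_of_mem_right t (B s)

theorem inner_blockB (B : H →L[ℂ] H) (x : Sᗮ) (t : S) :
    ⟪blockB B S x, t⟫_ℂ = ⟪B x, (t : H)⟫_ℂ :=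
  S.inner_orthogonalProjectionOnto_eq_of_mem_right t (B x)

/-- The orthogonal projection of `S` onto `Sp`. -/
theorem IsSignDecomposition.exists_isStarProjection (hS : IsSignDecomposition B S Sp Sm) :
    ∃ P : S →L[ℂ] S, IsStarProjection P ∧ (∀ s, (P s : H) ∈ Sp) ∧ (∀ s, ((1 - P) s : H) ∈ Sm) ∧
      (∀ s : S, (s : H) ∈ Sp → P s = s) ∧ (∀ s : S, (s : H) ∈ Sm → P s = 0) := by
  let M : Submodule ℂ S := Sp.comap S.subtype
  have hM : IsClosed (M : Set S) := hS.isClosed_pos.preimage continuous_subtype_val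
  have : CompleteSpace M := hM.completeSpace_coe
  have hp : ∀ s : S, (s : H) ∈ Sp → M.starProjection s = s := fun s hs =>
    Submodule.starProjection_eq_self_iff.2 hs
  have hm : ∀ s : S, (s : H) ∈ Sm → M.starProjection s = 0 := by
    intro s hs
    refine (Submodule.starProjection_apply_eq_zero_iff M).2 ?_
    rw [Submodule.mem_orthogonal]
    intro t ht
    exact hS.orthogonal _ ht _ hs
  refine ⟨M.starProjection, isStarProjection_starProjection,
    fun s => Submodule.starProjection_apply_mem M s, fun s => ?_, hp, hm⟩
  have hs : (s : H) ∈ Sp ⊔ Sm := by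
    rw [hS.sup_eq]
    exact s.2
  obtain ⟨p, hpm, m, hmm, hpms⟩ := Submodule.mem_sup.1 hs
  have hpS : p ∈ S := hS.sup_eq ▸ Submodule.mem_sup_left hpm
  have hmS : m ∈ S := hS.sup_eq ▸ Submodule.mem_sup_right hmm
  have hs' : s = ⟨p, hpS⟩ + ⟨m, hmS⟩ := Subtype.ext hpms.symm
  have : (1 - M.starProjection) s = ⟨m, hmS⟩ := by
    rw [sub_apply, one_apply_eq_self, hs', map_add, hp _ hpm, hm _ hmm]
    abel
  rw [this]
  exact hmm

end Blocks

/-! ### Cauchy–Schwarz bounds extracted from the extrema. -/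

section FormBounds

variable {H : Type*} [NormedAddCommGroup H] [InnerProductSpace ℂ H] [CompleteSpace H]
  {B : H →L[ℂ] H} {S Sp Sm : Submodule ℂ H}

theorem re_inner_add_self (hB : IsSelfAdjoint B) (x y : H) :
    (⟪B (x + y), x + y⟫_ℂ).re =
      (⟪B x, x⟫_ℂ).re + 2 * (⟪B x, y⟫_ℂ).re + (⟪B y, y⟫_ℂ).re := by
  have h : ⟪B x, y⟫_ℂ = ⟪x, B y⟫_ℂ := hB.isSymmetric _ _
  have h2 : (⟪B y, x⟫_ℂ).re = (⟪B x, y⟫_ℂ).re := by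
    rw [h]
    exact inner_re_symm (𝕜 := ℂ) _ _
  simp only [map_add, inner_add_left, inner_add_right, Complex.add_re, h2]
  ring

theorem norm_inner_sq_le_of_forall_re_inner_ge (hB : IsSelfAdjoint B) {M : Submodule ℂ H} {x : H}
    {C : ℝ} (h : ∀ s ∈ M, -C ≤ (⟪B (x + s), x + s⟫_ℂ).re) {s : H} (hs : s ∈ M)
    (hpos : 0 ≤ (⟪B s, s⟫_ℂ).re) :
    ‖⟪B x, s⟫_ℂ‖ ^ 2 ≤ (C + (⟪B x, x⟫_ℂ).re) * (⟪B s, s⟫_ℂ).re := by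
  set z := ⟪B x, s⟫_ℂ with hz
  have hq : ∀ t : ℝ, 0 ≤ (‖z‖ ^ 2 * (⟪B s, s⟫_ℂ).re) * (t * t) + (2 * ‖z‖ ^ 2) * t +
      (C + (⟪B x, x⟫_ℂ).re) := by
    intro t
    -- The factor conj z makes the cross term the real number t ‖z‖², leaving a nonnegative real
    -- quadratic in t.
    have h1 := h (((t : ℂ) * (starRingEnd ℂ) z) • s) (M.smul_mem _ hs)
    rw [re_inner_add_self hB] at h1
    have h2 : (⟪B x, ((t : ℂ) * (starRingEnd ℂ) z) • s⟫_ℂ).re = t * ‖z‖ ^ 2 := by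
      rw [inner_smul_right, ← hz, mul_assoc, Complex.conj_mul']
      norm_cast
    have h3 : (⟪B (((t : ℂ) * (starRingEnd ℂ) z) • s), ((t : ℂ) * (starRingEnd ℂ) z) • s⟫_ℂ).re =
        t * t * ‖z‖ ^ 2 * (⟪B s, s⟫_ℂ).re := by
      rw [map_smul, inner_smul_left, inner_smul_right, ← mul_assoc, Complex.conj_mul',
        norm_mul, RCLike.norm_conj, Complex.norm_real, Real.norm_eq_abs, ← Complex.ofReal_pow,
        Complex.re_ofReal_mul, mul_pow, sq_abs]
      ring
    rw [h2, h3] at h1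
    linarith
  have hd := discrim_le_zero hq
  have hC : 0 ≤ C + (⟪B x, x⟫_ℂ).re := by simpa using hq 0
  rw [discrim] at hd
  -- The discriminant bound carries an extra factor ‖z‖², so z = 0 is treated apart.
  rcases eq_or_lt_of_le (sq_nonneg ‖z‖) with h0 | h0
  · rw [← h0]
    positivity
  · nlinarith

theorem IsSupInf.exists_norm_inner_sq_le (hB : IsSelfAdjoint B)
    (hS : IsSignDecomposition B S Sp Sm) {X : H →L[ℂ] H} (hX : IsSupInf B Sp Sm X) :
    ∃ C : ℝ, 0 ≤ C ∧ ∀ x ∈ Sᗮ, ∀ s ∈ Sp,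
      ‖⟪B x, s⟫_ℂ‖ ^ 2 ≤ C * ‖x‖ ^ 2 * (⟪B s, s⟫_ℂ).re := by
  have : CompleteSpace Sp := hS.isClosed_pos.completeSpace_coe
  have : CompleteSpace Sm := hS.isClosed_neg.completeSpace_coe
  have hpS : Sp ≤ S := hS.sup_eq ▸ le_sup_left
  have hmS : Sm ≤ S := hS.sup_eq ▸ le_sup_right
  obtain ⟨T, hT, -⟩ := hX
  have hbound : ∀ (A : H →L[ℂ] H) (x : H), |(⟪A x, x⟫_ℂ).re| ≤ ‖A‖ * ‖x‖ ^ 2 := by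
    intro A x
    calc _ ≤ ‖⟪A x, x⟫_ℂ‖ := Complex.abs_re_le_norm _
      _ ≤ ‖A x‖ * ‖x‖ := norm_inner_le_norm _ _
      _ ≤ ‖A‖ * ‖x‖ * ‖x‖ := by gcongr; exact A.le_opNorm x
      _ = _ := by ring
  let Q : projWithKer Sm := ⟨_, one_sub_starProjection_mem_projWithKer Sm⟩
  -- ‖T Q‖ bounds the form below on x + Sp; ‖B‖ accounts for ⟪B x, x⟫.
  refine ⟨‖T Q‖ + ‖B‖, by positivity, fun x hx s hs => ?_⟩
  by_cases hx0 : x = 0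
  · simp [hx0]
  have hxp : x ∉ Sp := fun hxp => hx0 <|
    inner_self_eq_zero.1 (Submodule.inner_right_of_mem_orthogonal (hpS hxp) hx)
  have hQx : Q.1 x = x := by
    have : Sm.starProjection x = 0 :=
      (Submodule.starProjection_apply_eq_zero_iff Sm).2 (Submodule.orthogonal_le hmS hx)
    change x - Sm.starProjection x = x
    rw [this, sub_zero]
  have hlow : ∀ t ∈ Sp, -(‖T Q‖ * ‖x‖ ^ 2) ≤ (⟪B (x + t), x + t⟫_ℂ).re := by
    intro t ht
    obtain ⟨Qp, hQp, hq⟩ := exists_mem_projWithKer_apply_eq Sp hxp ht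
    have h1 := re_inner_le_of_le ((hT Q).1 ⟨Qp, hQp, rfl⟩) x
    simp only [comp_apply, adjoint_inner_left] at h1
    rw [hQx, hq] at h1
    linarith [neg_le_of_abs_le (hbound (T Q) x)]
  refine (norm_inner_sq_le_of_forall_re_inner_ge hB hlow hs (hS.nonneg s hs)).trans ?_
  gcongr
  · exact hS.nonneg s hs
  · linarith [le_of_abs_le (hbound B x)]

theorem IsSignDecomposition.neg (hS : IsSignDecomposition B S Sp Sm) (hB : IsSelfAdjoint B) :
    IsSignDecomposition (-B) S Sm Sp where
  isClosed_pos := hS.isClosed_neg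
  isClosed_neg := hS.isClosed_pos
  sup_eq := sup_comm Sp Sm ▸ hS.sup_eq
  orthogonal s hs t ht := inner_eq_zero_symm.1 (hS.orthogonal t ht s hs)
  orthogonal_form s hs t ht := by
    have h : ⟪B t, s⟫_ℂ = ⟪t, B s⟫_ℂ := hB.isSymmetric _ _
    rw [neg_apply, inner_neg_left, neg_eq_zero, inner_eq_zero_symm, ← h]
    exact hS.orthogonal_form t ht s hs
  nonneg s hs := by simpa using hS.nonpos s hs
  nonpos s hs := by simpa using hS.nonneg s hs

end FormBounds

/-! ### Both directions of the theorem. -/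

section Main

variable {H : Type*} [NormedAddCommGroup H] [InnerProductSpace ℂ H] [CompleteSpace H]
  {B : H →L[ℂ] H} {S Sp Sm : Submodule ℂ H} [CompleteSpace S]

theorem inner_blockC (B : H →L[ℂ] H) (x y : Sᗮ) : ⟪blockC B S x, y⟫_ℂ = ⟪B x, (y : H)⟫_ℂ :=
  Sᗮ.inner_orthogonalProjectionOnto_eq_of_mem_right y (B x)

theorem isSelfAdjoint_blockA (hB : IsSelfAdjoint B) : IsSelfAdjoint (blockA B S) := by
  rw [isSelfAdjoint_iff_isSymmetric]
  intro s t
  have h : ⟪B s, (t : H)⟫_ℂ = ⟪(s : H), B t⟫_ℂ := hB.isSymmetric _ _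
  change ⟪blockA B S s, t⟫_ℂ = ⟪s, blockA B S t⟫_ℂ
  rw [inner_blockA, h, ← inner_conj_symm, ← inner_blockA, inner_conj_symm]

theorem isSelfAdjoint_blockC (hB : IsSelfAdjoint B) : IsSelfAdjoint (blockC B S) := by
  rw [isSelfAdjoint_iff_isSymmetric]
  intro s t
  have h : ⟪B s, (t : H)⟫_ℂ = ⟪(s : H), B t⟫_ℂ := hB.isSymmetric _ _
  change ⟪blockC B S s, t⟫_ℂ = ⟪s, blockC B S t⟫_ℂ
  rw [inner_blockC, h, ← inner_conj_symm, ← inner_blockC, inner_conj_symm]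

/-- The quadratic form of `B` in terms of its matrix entries. -/
theorem re_inner_eq_blocks (hB : IsSelfAdjoint B) (z : H) :
    (⟪B z, z⟫_ℂ).re =
      (⟪blockC B S (Sᗮ.orthogonalProjectionOnto z), Sᗮ.orthogonalProjectionOnto z⟫_ℂ).re +
      2 * (⟪blockB B S (Sᗮ.orthogonalProjectionOnto z), S.orthogonalProjectionOnto z⟫_ℂ).re +
      (⟪blockA B S (S.orthogonalProjectionOnto z), S.orthogonalProjectionOnto z⟫_ℂ).re := by
  rw [inner_blockA, inner_blockB, inner_blockC, ← re_inner_add_self hB]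
  have : (Sᗮ.orthogonalProjectionOnto z : H) + S.orthogonalProjectionOnto z = z := by
    rw [add_comm]
    exact S.starProjection_add_starProjection_orthogonal z
  rw [this]

theorem IsSignDecomposition.isSignProjection_blockA (hB : IsSelfAdjoint B)
    (hS : IsSignDecomposition B S Sp Sm) {P : S →L[ℂ] S} (hP : IsStarProjection P)
    (hp : ∀ s, (P s : H) ∈ Sp) (hm : ∀ s, ((1 - P) s : H) ∈ Sm) :
    IsSignProjection (blockA B S) P where
  isSelfAdjoint := isSelfAdjoint_blockA hB
  isStarProjection := hP
  commute := by
    refine commute_of_one_sub_mul_mul_eq_zero (isSelfAdjoint_blockA hB) hP ?_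
    ext1 s
    refine ext_inner_right ℂ fun t => ?_
    have h : ⟪(1 - P) (blockA B S (P s)), t⟫_ℂ = ⟪blockA B S (P s), (1 - P) t⟫_ℂ :=
      hP.one_sub.isSelfAdjoint.isSymmetric _ _
    change ⟪(1 - P) (blockA B S (P s)), t⟫_ℂ = ⟪(0 : S), t⟫_ℂ
    rw [h, inner_blockA, hS.orthogonal_form _ (hp s) _ (hm t), inner_zero_left]
  nonneg x := by
    rw [inner_blockA]
    exact hS.nonneg _ (hp x)
  nonpos x := by
    rw [inner_blockA]
    exact hS.nonpos _ (hm x)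

theorem schurComplement_apply_eq_zero (h : WeaklyComplementable B S) {s : H} (hs : s ∈ S) :
    schurComplement B S h s = 0 := by
  have : Sᗮ.orthogonalProjectionOnto s = 0 := by
    rw [Submodule.orthogonalProjectionOnto_eq_zero_iff]
    exact S.le_orthogonal_orthogonal hs
  simp [schurComplement, this]

set_option maxHeartbeats 1000000 in
theorem IsSignDecomposition.isSupInf_and_isInfSup (hB : IsSelfAdjoint B)
    (hS : IsSignDecomposition B S Sp Sm) (h : WeaklyComplementable B S) :
    IsSupInf B Sp Sm (schurComplement B S h) ∧ IsInfSup B Sp Sm (schurComplement B S h) := by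
  obtain ⟨P, hP, hp, hm, hPp, hPm⟩ := hS.exists_isStarProjection
  have : CompleteSpace Sp := hS.isClosed_pos.completeSpace_coe
  have : CompleteSpace Sm := hS.isClosed_neg.completeSpace_coe
  have hpS : Sp ≤ S := hS.sup_eq ▸ le_sup_left
  have hmS : Sm ≤ S := hS.sup_eq ▸ le_sup_right
  have hsign := hS.isSignProjection_blockA hB hP hp hm
  set A := sqrtAbs (blockA B S)
  have hAsa : IsSelfAdjoint A := isSelfAdjoint_sqrtAbs _
  have hcA : Commute P A := hsign.commute_sqrtAbs
  have hcA' : Commute (1 - P) A := (Commute.one_left A).sub_left hcA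
  set f := reducedSolution A (blockB B S) h
  have hfspec : IsReducedSolution A (blockB B S) f := reducedSolution_spec _ _ h
  have hfmem : ∀ x, f x ∈ A.range.topologicalClosure := fun x => by
    have := hfspec.range_le ⟨x, rfl⟩
    rwa [hAsa.adjoint_eq] at this
  -- R(f) lies in the closure of R(A), where u and J coincide.
  have huf : polarFactor (blockA B S) ∘L f = (P - (1 - P)) ∘L f := by
    ext1 x
    exact hsign.polarFactor_apply (hfmem x)
  set K := schurComplement B S h
  have hK' : K = Sᗮ.subtypeL ∘L (blockC B S - adjoint f ∘L (P - (1 - P)) ∘L f) ∘L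
      Sᗮ.orthogonalProjectionOnto := by
    rw [← huf]
    rfl
  have hJs : IsSelfAdjoint (P - (1 - P)) := isSelfAdjoint_sign hP
  have hK : IsSelfAdjoint K := by
    have h1 : IsSelfAdjoint (blockC B S - adjoint f ∘L (P - (1 - P)) ∘L f) :=
      (isSelfAdjoint_blockC hB).sub (hJs.adjoint_conj f)
    have h2 := h1.conj_adjoint Sᗮ.subtypeL
    rwa [Submodule.adjoint_subtypeL, ← hK'] at h2
  have hKS : ∀ s ∈ S, K s = 0 := fun s hs => schurComplement_apply_eq_zero h hs
  let v : H →L[ℂ] S := A ∘L S.orthogonalProjectionOnto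
  let w : H →L[ℂ] S := f ∘L Sᗮ.orthogonalProjectionOnto
  have hvmem : ∀ z, v z ∈ A.range.topologicalClosure := fun z =>
    Submodule.le_topologicalClosure _ ⟨_, rfl⟩
  have hvS : ∀ s : S, v s = A s := fun s =>
    congrArg A (Submodule.orthogonalProjectionOnto_mem_subspace_eq_self s)
  have hwS : ∀ s ∈ S, w s = 0 := fun s hs => by
    have : Sᗮ.orthogonalProjectionOnto s = 0 := by
      rw [Submodule.orthogonalProjectionOnto_eq_zero_iff]
      exact S.le_orthogonal_orthogonal hs
    simp [w, this]
  have hPA : ∀ s, P (A s) = A (P s) := fun s =>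
    congrArg (fun T : S →L[ℂ] S => T s) hcA.eq
  have hLp : ∀ z, (P ∘L (v + w)) z = P (v z + w z) := fun _ => rfl
  have hLm : ∀ z, ((1 - P) ∘L (v - w)) z = (1 - P) (v z - w z) := fun _ => rfl
  have hform : ∀ z, (⟪B z, z⟫_ℂ).re = (⟪K z, z⟫_ℂ).re +
      ‖(P ∘L (v + w)) z‖ ^ 2 - ‖((1 - P) ∘L (v - w)) z‖ ^ 2 := by
    intro z
    have h1 : (⟪K z, z⟫_ℂ).re =
        (⟪blockC B S (Sᗮ.orthogonalProjectionOnto z), Sᗮ.orthogonalProjectionOnto z⟫_ℂ).re -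
          (⟪(P - (1 - P)) (w z), w z⟫_ℂ).re := by
      have h2 : ⟪K z, z⟫_ℂ = ⟪(blockC B S - adjoint f ∘L (P - (1 - P)) ∘L f)
          (Sᗮ.orthogonalProjectionOnto z), Sᗮ.orthogonalProjectionOnto z⟫_ℂ := by
        rw [hK']
        exact (Sᗮ.inner_orthogonalProjectionOnto_eq_of_mem_left _ z).symm
      rw [h2, sub_apply, inner_sub_left, Complex.sub_re, comp_apply, adjoint_inner_left]
      rfl
    have h3 : ⟪blockB B S (Sᗮ.orthogonalProjectionOnto z), S.orthogonalProjectionOnto z⟫_ℂ =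
        ⟪w z, v z⟫_ℂ := by
      have h4 : blockB B S (Sᗮ.orthogonalProjectionOnto z) = A (w z) :=
        congrArg (fun T : Sᗮ →L[ℂ] S => T (Sᗮ.orthogonalProjectionOnto z)) hfspec.eq
      rw [h4]
      exact hAsa.isSymmetric _ _
    have h5 : ⟪blockA B S (S.orthogonalProjectionOnto z), S.orthogonalProjectionOnto z⟫_ℂ =
        ⟪(P - (1 - P)) (v z), v z⟫_ℂ := by
      conv_lhs => rw [hsign.eq_sqrtAbs_mul]
      exact hAsa.isSymmetric _ _
    rw [re_inner_eq_blocks (S := S) hB, h1, h3, h5, hLp, hLm]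
    linarith [norm_sq_sub_norm_sq_eq hP (v z) (w z)]
  have hpz : ∀ t ∈ Sm, (P ∘L (v + w)) t = 0 := fun t ht => by
    have h1 := hvS ⟨t, hmS ht⟩
    rw [hLp, hwS t (hmS ht), add_zero, h1, hPA, hPm _ ht, map_zero]
  have hmz : ∀ s ∈ Sp, ((1 - P) ∘L (v - w)) s = 0 := fun s hs => by
    have h1 := hvS ⟨s, hpS hs⟩
    rw [hLm, hwS s (hpS hs), sub_zero, h1, sub_apply, hPA, hPp _ hs]
    exact sub_self _
  have hpa : ∀ z, ∀ ε > 0, ∃ s ∈ Sp, ‖(P ∘L (v + w)) (z + s)‖ ^ 2 ≤ ε := by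
    intro z ε hε
    obtain ⟨s, hs⟩ := exists_norm_apply_add_sq_le hP hcA
      (Submodule.add_mem _ (hvmem z) (hfmem (Sᗮ.orthogonalProjectionOnto z))) hε
    refine ⟨P s, hp s, ?_⟩
    rwa [hLp, map_add v, map_add w, hwS _ (P s).2, hvS, add_zero, add_right_comm]
  have hma : ∀ z, ∀ ε > 0, ∃ t ∈ Sm, ‖((1 - P) ∘L (v - w)) (z + t)‖ ^ 2 ≤ ε := by
    intro z ε hε
    obtain ⟨s, hs⟩ := exists_norm_apply_add_sq_le hP.one_sub hcA'
      (Submodule.sub_mem _ (hvmem z) (hfmem (Sᗮ.orthogonalProjectionOnto z))) hε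
    refine ⟨(1 - P) s, hm s, ?_⟩
    rwa [hLm, map_add v, map_add w, hwS _ ((1 - P) s).2, hvS, add_zero, add_sub_right_comm]
  refine ⟨isSupInf_of_form_eq hB hK _ _ hform (fun s hs => hKS s (hpS hs))
    (fun s hs => hKS s (hmS hs)) hmz hpa hma, ?_⟩
  -- For -B the two squares trade places.
  have hneg := isSupInf_of_form_eq hB.neg hK.neg (Sp := Sm) (Sm := Sp)
    ((1 - P) ∘L (v - w)) (P ∘L (v + w)) (fun z => by
      rw [neg_apply, neg_apply, inner_neg_left, inner_neg_left, Complex.neg_re, Complex.neg_re,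
        hform z]
      ring)
    (fun s hs => by rw [neg_apply, hKS s (hmS hs), neg_zero])
    (fun s hs => by rw [neg_apply, hKS s (hpS hs), neg_zero]) hpz hma hpa
  simpa using hneg.neg

theorem IsSignDecomposition.weaklyComplementable (hB : IsSelfAdjoint B)
    (hS : IsSignDecomposition B S Sp Sm) {X Y : H →L[ℂ] H} (hX : IsSupInf B Sp Sm X)
    (hY : IsInfSup B Sp Sm Y) : WeaklyComplementable B S := by
  obtain ⟨C, hC, hCp⟩ := hX.exists_norm_inner_sq_le hB hS
  obtain ⟨D, hD, hDm⟩ := hY.neg.exists_norm_inner_sq_le hB.neg (hS.neg hB)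
  obtain ⟨P, hP, hp, hm, -, -⟩ := hS.exists_isStarProjection
  have hsign := hS.isSignProjection_blockA hB hP hp hm
  -- The 2 comes from (α + β)² ≤ 2(α² + β²); C + D absorbs both one-sided constants. The test vector
  -- is x = b* s, for which ‖x‖² = ⟪B x, s⟫.
  refine range_le_range_of_norm_adjoint_le _ _ (√(2 * (C + D))) fun s => ?_
  rw [(isSelfAdjoint_sqrtAbs (blockA B S)).adjoint_eq]
  set x := adjoint (blockB B S) s with hx
  have hA : ‖sqrtAbs (blockA B S) s‖ ^ 2 =
      (⟪B (P s), (P s : H)⟫_ℂ).re - (⟪B ((1 - P) s), ((1 - P) s : H)⟫_ℂ).re := by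
    rw [hsign.norm_sqrtAbs_sq, inner_blockA, inner_blockA]
  have h1 := hCp x x.2 (P s) (hp s)
  have h2 := hDm x x.2 ((1 - P) s) (hm s)
  simp only [neg_apply, inner_neg_left, norm_neg, Complex.neg_re] at h2
  have hpos := hS.nonneg _ (hp s)
  have hneg := hS.nonpos _ (hm s)
  have h3 : ⟪x, x⟫_ℂ = ⟪B x, (P s : H)⟫_ℂ + ⟪B x, ((1 - P) s : H)⟫_ℂ := by
    have h4 : (s : H) = P s + (1 - P) s := by simp
    rw [← inner_add_right, ← h4, ← inner_blockB]
    conv_lhs => rw [hx]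
    exact adjoint_inner_right _ _ _
  have h5 : ‖x‖ ^ 2 ≤ ‖⟪B x, (P s : H)⟫_ℂ‖ + ‖⟪B x, ((1 - P) s : H)⟫_ℂ‖ := by
    refine le_trans (le_of_eq ?_) (norm_add_le _ _)
    rw [← h3, inner_self_eq_norm_sq_to_K]
    simp
  set α := ‖⟪B x, (P s : H)⟫_ℂ‖
  set β := ‖⟪B x, ((1 - P) s : H)⟫_ℂ‖
  have hxn : ‖(x : H)‖ = ‖x‖ := rfl
  rw [hxn] at h1 h2
  have h6 : ‖x‖ ^ 2 * ‖x‖ ^ 2 ≤ ‖x‖ ^ 2 * (2 * (C + D) * ‖sqrtAbs (blockA B S) s‖ ^ 2) := by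
    have h7 : ‖x‖ ^ 2 * ‖x‖ ^ 2 ≤ (α + β) * (α + β) := by gcongr
    have h8 : (α + β) * (α + β) ≤ 2 * (α ^ 2 + β ^ 2) := by nlinarith [sq_nonneg (α - β)]
    -- Cross terms of the product of C + D with the two parts of ‖A s‖², dropped by sign.
    have h9 : 0 ≤ C * ‖x‖ ^ 2 * -(⟪B ((1 - P) s), ((1 - P) s : H)⟫_ℂ).re :=
      mul_nonneg (by positivity) (by linarith)
    have h10 : 0 ≤ D * ‖x‖ ^ 2 * (⟪B (P s), (P s : H)⟫_ℂ).re :=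
      mul_nonneg (by positivity) hpos
    rw [hA]
    linarith
  have h11 : ‖x‖ ^ 2 ≤ 2 * (C + D) * ‖sqrtAbs (blockA B S) s‖ ^ 2 := by
    rcases eq_or_lt_of_le (sq_nonneg ‖x‖) with h0 | h0
    · rw [← h0]
      positivity
    · exact le_of_mul_le_mul_left h6 h0
  refine abs_le_of_sq_le_sq' ?_ (by positivity) |>.2
  rwa [mul_pow, Real.sq_sqrt (by positivity)]

end Main

end SchurMinMax

theorem theorem3p7 {H : Type*} [NormedAddCommGroup H] [InnerProductSpace ℂ H] [CompleteSpace H]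
    (B : H →L[ℂ] H) (hB : IsSelfAdjoint B)
    (S Sp Sm : Submodule ℂ H) [CompleteSpace S]
    (hS : SchurMinMax.IsSignDecomposition B S Sp Sm) :
    (SchurMinMax.WeaklyComplementable B S ↔
      (∃ X, SchurMinMax.IsSupInf B Sp Sm X) ∧ (∃ Y, SchurMinMax.IsInfSup B Sp Sm Y)) ∧
    ∀ h : SchurMinMax.WeaklyComplementable B S,
      SchurMinMax.IsSupInf B Sp Sm (SchurMinMax.schurComplement B S h) ∧
      SchurMinMax.IsInfSup B Sp Sm (SchurMinMax.schurComplement B S h) := by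
  exact ⟨⟨fun h => ⟨⟨_, (hS.isSupInf_and_isInfSup hB h).1⟩,
      ⟨_, (hS.isSupInf_and_isInfSup hB h).2⟩⟩,
      fun h => h.1.elim fun _ hX => h.2.elim fun _ hY => hS.weaklyComplementable hB hX hY⟩,
    fun h => hS.isSupInf_and_isInfSup hB h⟩
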